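/- Let $A$ and $B$ be quantum systems of finite dimensions $d_A,d_B\ge 1$, let $\mathcal K$ and $\mathcal X$ be finite sets (for example $\mathcal K=\mathcal X$), and let ${\rm tr}$ be the trace. A channel is a completely positive trace-preserving linear map; an instrument from $A$ to $B$ with outcome set $\mathcal X$ is a family $\mathcal E=\{\mathcal E_x\}_{x\in\mathcal X}$ of completely positive linear maps from operators on $A$ to operators on $B$ whose sum is a channel. Let ${\bf AO}^{A\to B}_{\mathcal K\to\mathcal X}$, the set of allowed operations, be the convex hull of the set of all transformations $\Pi$ of the form $$\Pi(\mathcal E)_x=\sum_{k\in\mathcal K}P(x|k)\,\mathcal D_k\circ\mathcal E_k\circ\mathcal P\qquad(x\in\mathcal X),$$ where $\mathcal P$ is a channel from $A$ to $A$, each $\mathcal D_k$ is a channel from $B$ to $B$, and $P(\cdot|k)$ is a probability distribution on $\mathcal X$ for each $k$. Such operations map instruments from $A$ to $B$ with outcome set $\mathcal K$ to instruments from $A$ to $B$ with outcome set $\mathcal X$. Let $\Phi_+=|\Phi_+\rangle\langle\Phi_+|$ with $|\Phi_+\rangle=d_A^{-1/2}\sum_i|i\rangle\otimes|i\rangle$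 be the maximally entangled state on two copies of $A$. For a POVM $Q=\{Q_m\}_{m\in\mathcal X\cup\{\emptyset\}}$ on $AB$, where $\emptyset$ is an additional (inconclusive) outcome, and instruments $\mathcal F$ with outcome set $\mathcal X$ and $\mathcal G$ with an arbitrary finite outcome set $\mathcal L$, both from $A$ to $B$, put $$P_{\rm succ}(\mathcal F,Q)=\sum_{x\in\mathcal X}{\rm tr}\big[Q_x\,({\rm id}^A\otimes\mathcal F_x)(\Phi_+)\big],\qquad P_{\max}(\mathcal G,Q)=\max_{\Pi\in{\bf AO}^{A\to B}_{\mathcal L\to\mathcal X}}P_{\rm succ}(\Pi(\mathcal G),Q).$$ Let $\mathcal E$ and $\mathcal N$ be instruments from $A$ to $B$ with outcome sets $\mathcal K$ and $\mathcal X$, respectively. Then the maxima defining $P_{\max}(\mathcal E,Q)$ and $P_{\max}(\mathcal N,Q)$ are attained for every POVM $Q=\{Q_m\}_{m\in\mathcal X\cup\{\emptyset\}}$ on $AB$, and there is an allowed operation $\Pi\in{\bf AO}^{A\to B}_{\mathcal K\to\mathcal X}$ with $\Pi(\mathcal E)=\mathcal N$ if and only if $$P_{\max}(\mathcal E,Q)\ge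 P_{\max}(\mathcal N,Q)\qquad\text{for every POVM }Q=\{Q_m\}_{m\in\mathcal X\cup\{\emptyset\}}\text{ on }AB.$$ -/

import Mathlib

open scoped ComplexOrder

namespace InteractiveInstruments

/-- Linear maps from operators on `A` to operators on `B`. A finite-dimensional quantum system is
given by the finite index type of its computational basis, operators are complex matrices. -/
abbrev Superop (A B : Type*) : Type _ := Matrix A A ℂ →ₗ[ℂ] Matrix B B ℂ

/-- The action of `id ⊗ F` on operators on `R ⊗ A`: the map `F` is applied to every block
`(⟨r| ⊗ 1) M (|s⟩ ⊗ 1)` of `M`. -/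
def idTensor (R : Type*) {A B : Type*} (F : Superop A B) (M : Matrix (R × A) (R × A) ℂ) :
    Matrix (R × B) (R × B) ℂ :=
  Matrix.of fun p q => F (Matrix.of fun a a' => M (p.1, a) (q.1, a')) p.2 q.2

/-- Complete positivity: `id ⊗ F` preserves positive semidefiniteness, for an ancilla of
arbitrary finite dimension. -/
def IsCP {A B : Type*} (F : Superop A B) : Prop :=
  ∀ (k : ℕ) (M : Matrix (Fin k × A) (Fin k × A) ℂ),
    M.PosSemidef → (idTensor (Fin k) F M).PosSemidef

/-- A (quantum) channel: a completely positive trace-preserving linear map. -/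
structure IsChannel {A B : Type*} [Fintype A] [Fintype B] (F : Superop A B) : Prop where
  cp : IsCP F
  trace_map : ∀ M : Matrix A A ℂ, (F M).trace = M.trace

/-- An instrument from `A` to `B` with classical outcomes in `K`: a family of completely positive
maps whose sum is a channel (so that every member is trace-non-increasing). -/
structure IsInstrument {A B K : Type*} [Fintype A] [Fintype B] [Fintype K]
    (E : K → Superop A B) : Prop where
  cp : ∀ k, IsCP (E k)
  channel : IsChannel (∑ k, E k)

/-- A POVM with outcomes in `ι` on the system `H`. -/
structure POVM (ι H : Type*) [Fintype ι] [DecidableEq H] where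
  effect : ι → Matrix H H ℂ
  posSemidef : ∀ i, (effect i).PosSemidef
  sum_eq_one : ∑ i, effect i = 1

/-- The maximally entangled vector `(1/√d_A) ∑ᵢ |i⟩|i⟩` on `A ⊗ A`. -/
noncomputable def maxEntKet (A : Type*) [Fintype A] [DecidableEq A] : A × A → ℂ :=
  fun p => if p.1 = p.2 then ((1 / √(Fintype.card A : ℝ) : ℝ) : ℂ) else 0

/-- The maximally entangled state `Φ₊ = |Φ₊⟩⟨Φ₊|` on `A ⊗ A`. -/
noncomputable def maxEnt (A : Type*) [Fintype A] [DecidableEq A] :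
    Matrix (A × A) (A × A) ℂ :=
  Matrix.vecMulVec (maxEntKet A) (star (maxEntKet A))

/-- The success probability `∑ₐ tr[Qₐ (id ⊗ Eₐ)(Φ₊)]`. The POVM has one more outcome than `E`,
the inconclusive outcome `none`. (For an instrument all the traces are real.) -/
noncomputable def pSucc {A B X : Type*} [Fintype A] [DecidableEq A] [Fintype B] [DecidableEq B]
    [Fintype X] (E : X → Superop A B) (Q : POVM (Option X) (A × B)) : ℝ :=
  ∑ x, (Matrix.trace (Q.effect (some x) * idTensor A (E x) (maxEnt A))).re

/-- Transformations `Π(E)ₐ = ∑ₖ P(a|k) (Dₖ ∘ Eₖ ∘ C)` of families with outcomes in `K` to families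
with outcomes in `X`, where the pre-processing `C` and the conditional post-processings `Dₖ` are
channels and `P(·|k)` is a probability distribution for every `k`. -/
def preAO (A B K X : Type*) [Fintype A] [Fintype B] [Fintype K] [Fintype X] :
    Set ((K → Superop A B) → (X → Superop A B)) :=
  {Θ | ∃ (C : Superop A A) (D : K → Superop B B) (P : K → X → ℝ),
    IsChannel C ∧ (∀ k, IsChannel (D k)) ∧ (∀ k, P k ∈ stdSimplex ℝ X) ∧
    ∀ E x, Θ E x = ∑ k, P k x • (D k ∘ₗ E k ∘ₗ C)}

/-- The allowed operations: all convex mixtures of the transformations in `preAO`, that is,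
`Π(E)ₐ = ∑_{l,k} q(l) P(a|k,l) (D_{k|l} ∘ Eₖ ∘ C_l)`. -/
def AO (A B K X : Type*) [Fintype A] [Fintype B] [Fintype K] [Fintype X] :
    Set ((K → Superop A B) → (X → Superop A B)) :=
  convexHull ℝ (preAO A B K X)

/-- The success probabilities for `Q` that can be reached from `E` by allowed operations. -/
def reachable {A B K X : Type*} [Fintype A] [DecidableEq A] [Fintype B] [DecidableEq B]
    [Fintype K] [Fintype X] (E : K → Superop A B) (Q : POVM (Option X) (A × B)) : Set ℝ :=
  {p | ∃ Θ ∈ AO A B K X, p = pSucc (Θ E) Q}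

/-- The largest success probability for `Q` that can be reached from `E` by allowed operations. -/
noncomputable def pMax {A B K X : Type*} [Fintype A] [DecidableEq A] [Fintype B] [DecidableEq B]
    [Fintype K] [Fintype X] (E : K → Superop A B) (Q : POVM (Option X) (A × B)) : ℝ :=
  sSup (reachable E Q)

end InteractiveInstruments

/-! Forward direction: allowed operations compose (`AO_comp`), so whatever is reachable from `Θ E`
is reachable from `E`, and the maxima are ordered. Converse: identify maps with their Choi
operators. The families reachable from `E` form a convex compact set: the hull of a continuous image
of a compact parameter space (`isCompact_reachableChoi`). This also gives attainment of the maxima.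
If `N` lies outside, Hahn–Banach yields matrices `H x` whose trace pairing is strictly larger on `N`
than on everything reachable. On Hermitian families of total trace one, this pairing agrees up to a
positive affine change with the success probability of a POVM: shifting each `H x` by a multiple of
the identity adds a constant, and the inconclusive outcome absorbs what is missing from the identity
(`exists_povm_affine`). Since the identity is allowed, `pSucc N Q ≤ pMax N Q`, so this POVM violates
the assumed inequality. -/

namespace InteractiveInstruments

/-! ### Convex hulls and separation in finite dimension -/

section Convexity

/-- In a finite-dimensional space the convex hull of a compact set is compact. -/
theorem isCompact_convexHull_of_finiteDimensional {V : Type*} [NormedAddCommGroup V]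
    [NormedSpace ℝ V] [FiniteDimensional ℝ V] {s : Set V} (hs : IsCompact s) :
    IsCompact (convexHull ℝ s) := by
  have key : convexHull ℝ s = ⋃ m ∈ Set.Iic (Module.finrank ℝ V + 1),
      (fun p : (Fin m → ℝ) × (Fin m → V) => ∑ i, p.1 i • p.2 i) ''
        (stdSimplex ℝ (Fin m) ×ˢ Set.univ.pi fun _ => s) := by
    apply Set.Subset.antisymm
    · intro x hx
      -- Carathéodory: affinely independent points suffice, hence at most `finrank + 1` of them. The
      -- hull is thus a finite union of continuous images of compact sets.
      obtain ⟨ι, _, z, w, hz, hind, hw, hw1, hx⟩ := eq_pos_convex_span_of_mem_convexHull hx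
      simp only [Set.mem_iUnion, Set.mem_image, Prod.exists]
      have e := Fintype.equivFin ι
      refine ⟨Fintype.card ι, ?_, w ∘ e.symm, z ∘ e.symm, ⟨⟨fun i => (hw _).le, ?_⟩,
        fun i _ => hz ⟨_, rfl⟩⟩, ?_⟩
      · have := hind.card_le_finrank_succ
        have h2 := Submodule.finrank_le (vectorSpan ℝ (Set.range z))
        simp only [Set.mem_Iic]
        omega
      · rw [← hw1]
        exact e.symm.sum_comp w
      · rw [← hx]
        exact e.symm.sum_comp fun i => w i • z i
    · refine Set.iUnion₂_subset fun m _ => ?_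
      rintro _ ⟨⟨w, z⟩, ⟨⟨hw, hw1⟩, hz⟩, rfl⟩
      exact (convex_convexHull ℝ s).sum_mem (fun i _ => hw i) hw1
        fun i hi => subset_convexHull ℝ s (hz i (Set.mem_univ i))
  rw [key]
  refine (Set.finite_Iic _).isCompact_biUnion fun m _ => ?_
  refine ((isCompact_stdSimplex ℝ (Fin m)).prod (isCompact_univ_pi fun _ => hs)).image ?_
  fun_prop

/-- A family of matrices outside a closed convex set is separated from it by trace pairings. -/
theorem exists_trace_separation {X n : Type*} [Fintype X] [Fintype n]
    {S : Set (X → Matrix n n ℂ)} (hc : Convex ℝ S) (hcl : IsClosed S)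
    {N : X → Matrix n n ℂ} (hN : N ∉ S) :
    ∃ (H : X → Matrix n n ℂ) (u : ℝ), (∀ M ∈ S, ∑ x, ((H x * M x).trace).re < u) ∧
      u < ∑ x, ((H x * N x).trace).re := by
  classical
  let S' : Set (X → n → n → ℂ) := S
  have hc' : Convex ℝ S' := hc
  have hcl' : IsClosed S' := hcl
  obtain ⟨f, u, h1, h2⟩ := RCLike.geometric_hahn_banach_closed_point (𝕜 := ℂ) hc' hcl' hN
  -- The functional is represented by its values on matrix units; the indices are transposed because
  -- the trace of `H x * M x` pairs entry `(q, p)` with entry `(p, q)`.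
  let H : X → Matrix n n ℂ := fun x => Matrix.of fun q p =>
    f (Pi.single x (Pi.single p (Pi.single q 1)))
  have hf : ∀ M : X → Matrix n n ℂ, RCLike.re (f M) = ∑ x, ((H x * M x).trace).re := by
    intro M
    have hM : (M : X → n → n → ℂ) =
        ∑ x, ∑ p, ∑ q, M x p q • Pi.single x (Pi.single p (Pi.single q 1)) := by
      ext x p q
      simp [Finset.sum_apply, Pi.single_apply, ite_apply]
    have : f M = ∑ x, (H x * M x).trace := by
      conv_lhs => rw [hM]
      simp only [map_sum, map_smul, Matrix.trace, Matrix.diag, Matrix.mul_apply, H,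
        Matrix.of_apply, smul_eq_mul]
      refine Finset.sum_congr rfl fun x _ => ?_
      rw [Finset.sum_comm]
      exact Finset.sum_congr rfl fun _ _ => Finset.sum_congr rfl fun _ _ => mul_comm _ _
    rw [this]
    simp
  refine ⟨H, u, fun M hM => ?_, ?_⟩
  · rw [← hf]
    exact h1 M hM
  · rw [← hf]
    exact h2

end Convexity

/-! ### Positive semidefinite matrices -/

section PosSemidef

variable {n : Type*} [Fintype n]

theorem isClosed_setOf_posSemidef : IsClosed {M : Matrix n n ℂ | M.PosSemidef} := by
  have : {M : Matrix n n ℂ | M.PosSemidef} =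
      {M | M.conjTranspose = M} ∩ ⋂ x : n → ℂ, {M | 0 ≤ star x ⬝ᵥ M.mulVec x} := by
    ext M
    simp [Matrix.posSemidef_iff_dotProduct_mulVec, Matrix.IsHermitian]
  rw [this]
  refine (isClosed_eq (by fun_prop) continuous_id).inter (isClosed_iInter fun x => ?_)
  exact isClosed_le continuous_const (by fun_prop)

/-- Writing `M = B* B`, an entry is an inner product of two columns of `B`, and each squared column
norm is at most the trace. This bounds the Choi operators of channels. -/
theorem norm_apply_le_trace {M : Matrix n n ℂ} (hM : M.PosSemidef) (i j : n) :
    ‖M i j‖ ≤ M.trace.re := by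
  classical
  obtain ⟨B, rfl⟩ : ∃ B : Matrix n n ℂ, M = B.conjTranspose * B := by
    open scoped MatrixOrder in
    obtain ⟨B, hB⟩ := CStarAlgebra.nonneg_iff_eq_star_mul_self.mp hM.nonneg
    exact ⟨B, hB⟩
  have htr : ((B.conjTranspose * B).trace).re = ∑ i, ∑ r, ‖B r i‖ ^ 2 := by
    simp [Matrix.trace, Matrix.mul_apply, ← Complex.normSq_eq_norm_sq, Complex.normSq_apply]
  have hcol : ∀ i, ∑ r, ‖B r i‖ ^ 2 ≤ ((B.conjTranspose * B).trace).re := fun i => by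
    rw [htr]
    exact Finset.single_le_sum (f := fun i => ∑ r, ‖B r i‖ ^ 2)
      (fun i _ => Finset.sum_nonneg fun r _ => by positivity) (Finset.mem_univ i)
  have h1 : ‖(B.conjTranspose * B) i j‖ ≤ ∑ r, (‖B r i‖ ^ 2 + ‖B r j‖ ^ 2) / 2 := by
    rw [Matrix.mul_apply]
    refine (norm_sum_le _ _).trans (Finset.sum_le_sum fun r _ => ?_)
    simp only [Matrix.conjTranspose_apply, norm_mul, norm_star]
    linarith [two_mul_le_add_sq ‖B r i‖ ‖B r j‖]
  rw [← Finset.sum_div, Finset.sum_add_distrib] at h1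
  linarith [hcol i, hcol j]

/-- Adding a large multiple of the identity makes a Hermitian matrix positive semidefinite. -/
theorem exists_posSemidef_add_smul_one [DecidableEq n] {H : Matrix n n ℂ} (hH : H.IsHermitian) :
    ∃ c₀ : ℝ, ∀ c : ℝ, c₀ ≤ c → (H + (c : ℂ) • (1 : Matrix n n ℂ)).PosSemidef := by
  open scoped MatrixOrder Matrix.Norms.L2Operator in
  refine ⟨‖H‖, fun c hc => ?_⟩
  -- In the Loewner order `-‖H‖ • 1 ≤ H`, so the operator norm serves as `c₀`.
  have h := Matrix.le_iff.mp (IsSelfAdjoint.neg_algebraMap_norm_le_self (a := H) hH)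
  have h2 : ((((c - ‖H‖ : ℝ)) : ℂ) • (1 : Matrix n n ℂ)).PosSemidef :=
    Matrix.PosSemidef.one.smul (by exact_mod_cast sub_nonneg.mpr hc)
  have h3 : H + (c : ℂ) • (1 : Matrix n n ℂ) =
      (H - -algebraMap ℝ (Matrix n n ℂ) ‖H‖) + (((c - ‖H‖ : ℝ)) : ℂ) • (1 : Matrix n n ℂ) := by
    rw [Algebra.algebraMap_eq_smul_one]
    ext i j
    simp [Matrix.one_apply]
    split_ifs <;> ring
  rw [h3]
  exact h.add h2

end PosSemidef

/-! ### Completely positive maps and channels -/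

section CompletePositivity

variable {A B C : Type*}

theorem IsCP.id : IsCP (LinearMap.id : Superop A A) := fun _ _ hM => hM

theorem IsCP.comp {F : Superop B C} {G : Superop A B} (hF : IsCP F) (hG : IsCP G) :
    IsCP (F ∘ₗ G) := fun k M hM => hF k _ (hG k M hM)

theorem idTensor_sum_smul {ι : Type*} (s : Finset ι) (R : Type*) (p : ι → ℝ) (F : ι → Superop A B)
    (M : Matrix (R × A) (R × A) ℂ) :
    idTensor R (∑ i ∈ s, p i • F i) M = ∑ i ∈ s, p i • idTensor R (F i) M := by
  ext x y
  simp [idTensor, LinearMap.sum_apply, Matrix.sum_apply]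

theorem _root_.Matrix.PosSemidef.real_smul {n : Type*} {M : Matrix n n ℂ} (hM : M.PosSemidef)
    {c : ℝ} (hc : 0 ≤ c) : (c • M).PosSemidef := by
  have := hM.smul (α := ℂ) (a := (c : ℂ)) (by exact_mod_cast hc)
  convert this using 1
  ext i j
  simp

theorem IsCP.sum_smul {ι : Type*} (s : Finset ι) {p : ι → ℝ} (hp : ∀ i, 0 ≤ p i)
    {F : ι → Superop A B} (hF : ∀ i, IsCP (F i)) : IsCP (∑ i ∈ s, p i • F i) := by
  intro k M hM
  rw [idTensor_sum_smul]
  exact Matrix.posSemidef_sum _ fun i _ => (hF i k M hM).real_smul (hp i)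

/-- Relabelling `R` as `Fin k` reduces to the definition; needed with ancilla `A` for Choi
operators. -/
theorem IsCP.posSemidef_idTensor [Fintype A] {R : Type*} [Fintype R] {F : Superop A B} (hF : IsCP F)
    {M : Matrix (R × A) (R × A) ℂ} (hM : M.PosSemidef) : (idTensor R F M).PosSemidef := by
  let e := Fintype.equivFin R
  have h := hF _ _ (hM.submatrix (Prod.map e.symm _root_.id))
  have h2 := h.submatrix (Prod.map e _root_.id)
  convert h2 using 1
  ext p q
  simp [idTensor]

variable [Fintype A] [Fintype B] [Fintype C]

theorem IsChannel.id : IsChannel (LinearMap.id : Superop A A) := ⟨IsCP.id, fun _ => rfl⟩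

theorem IsChannel.comp {F : Superop B C} {G : Superop A B} (hF : IsChannel F) (hG : IsChannel G) :
    IsChannel (F ∘ₗ G) :=
  ⟨hF.cp.comp hG.cp, fun M => (hF.trace_map _).trans (hG.trace_map M)⟩

end CompletePositivity

/-! ### The Choi isomorphism and compactness of the set of channels -/

section Choi

variable {A B : Type*} [Fintype A]

/-- The linear map with a given Choi operator. -/
noncomputable def ofChoi (M : Matrix (A × B) (A × B) ℂ) : Superop A B where
  toFun Y := Matrix.of fun b b' => (Fintype.card A : ℂ) * ∑ a, ∑ a', Y a a' * M (a, b) (a', b')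
  map_add' Y Z := by
    ext
    simp [add_mul, Finset.sum_add_distrib, mul_add]
  map_smul' c Y := by
    ext
    simp only [Matrix.smul_apply, smul_eq_mul, Matrix.of_apply, RingHom.id_apply, mul_assoc,
      ← Finset.mul_sum]
    ring

theorem ofChoi_apply (M : Matrix (A × B) (A × B) ℂ) (Y : Matrix A A ℂ) (b b' : B) :
    ofChoi M Y b b' = (Fintype.card A : ℂ) * ∑ a, ∑ a', Y a a' * M (a, b) (a', b') := rfl

theorem continuous_ofChoi_apply {T : Type*} [TopologicalSpace T]
    {m : T → Matrix (A × B) (A × B) ℂ} {y : T → Matrix A A ℂ} (hm : Continuous m)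
    (hy : Continuous y) : Continuous fun t => ofChoi (m t) (y t) := by
  refine continuous_matrix fun b b' => ?_
  simp only [ofChoi_apply]
  fun_prop

theorem isClosed_setOf_isChannel_ofChoi [Fintype B] :
    IsClosed {M : Matrix (A × B) (A × B) ℂ | IsChannel (ofChoi M)} := by
  have h : {M : Matrix (A × B) (A × B) ℂ | IsChannel (ofChoi M)} =
      (⋂ (k : ℕ) (Y : Matrix (Fin k × A) (Fin k × A) ℂ) (_ : Y.PosSemidef),
        {M | (idTensor (Fin k) (ofChoi M) Y).PosSemidef}) ∩
      ⋂ Y : Matrix A A ℂ, {M | (ofChoi M Y).trace = Y.trace} := by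
    ext M
    simp only [Set.mem_ofPred_eq, Set.mem_inter_iff, Set.mem_iInter]
    exact ⟨fun h => ⟨h.1, h.2⟩, fun h => ⟨h.1, h.2⟩⟩
  have hcont : ∀ Y : Matrix A A ℂ, Continuous fun M : Matrix (A × B) (A × B) ℂ => ofChoi M Y :=
    fun Y => continuous_ofChoi_apply continuous_id continuous_const
  rw [h]
  refine IsClosed.inter ?_ (isClosed_iInter fun Y => ?_)
  · refine isClosed_iInter fun k => ?_
    refine isClosed_iInter fun Y => ?_
    refine isClosed_iInter fun _ => ?_
    have hk : Continuous fun M : Matrix (A × B) (A × B) ℂ => idTensor (Fin k) (ofChoi M) Y :=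
      continuous_matrix fun p q =>
        (hcont (Matrix.of fun a a' => Y (p.1, a) (q.1, a'))).matrix_elem p.2 q.2
    exact isClosed_setOf_posSemidef.preimage hk
  · exact isClosed_eq (hcont Y).matrix_trace continuous_const

variable [DecidableEq A]

/-- The Choi operator of `F`, as an element of a linear space over the reals. -/
noncomputable def choi : Superop A B →ₗ[ℝ] Matrix (A × B) (A × B) ℂ where
  toFun F := idTensor A F (maxEnt A)
  map_add' F G := by ext; simp [idTensor]
  map_smul' c F := by ext; simp [idTensor]

theorem maxEnt_posSemidef : (maxEnt A).PosSemidef := Matrix.posSemidef_vecMulVec_self_star _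

theorem IsCP.posSemidef_choi {F : Superop A B} (hF : IsCP F) : (choi F).PosSemidef :=
  hF.posSemidef_idTensor maxEnt_posSemidef

theorem maxEnt_block (a a' : A) :
    (Matrix.of fun c c' => maxEnt A (a, c) (a', c')) =
      Matrix.single a a' ((Fintype.card A : ℂ)⁻¹) := by
  have h : (((√(Fintype.card A : ℝ))⁻¹ : ℝ) : ℂ) * (((√(Fintype.card A : ℝ))⁻¹ : ℝ) : ℂ) =
      (Fintype.card A : ℂ)⁻¹ := by
    rw [← Complex.ofReal_mul, ← mul_inv, Real.mul_self_sqrt (Nat.cast_nonneg _)]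
    simp
  ext c c'
  by_cases h1 : a = c <;> by_cases h2 : a' = c' <;>
    simp [maxEnt, maxEntKet, Matrix.vecMulVec_apply, h1, h2]
  simpa using h

theorem choi_apply (F : Superop A B) (p q : A × B) :
    choi F p q = F (Matrix.single p.1 q.1 ((Fintype.card A : ℂ)⁻¹)) p.2 q.2 := by
  rw [← maxEnt_block]
  rfl

variable [Nonempty A]

/-- The factor `card A` in `ofChoi` cancels the normalization of the maximally entangled state,
which requires `A` to be nonempty. -/
theorem ofChoi_choi (F : Superop A B) : ofChoi (choi F) = F := by
  refine LinearMap.ext fun Y => ?_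
  have hd : (Fintype.card A : ℂ) ≠ 0 := Nat.cast_ne_zero.mpr Fintype.card_ne_zero
  ext b b'
  conv_rhs => rw [Matrix.matrix_eq_sum_single Y]
  simp only [ofChoi_apply, choi_apply, map_sum, Matrix.sum_apply, Finset.mul_sum]
  refine Finset.sum_congr rfl fun a _ => Finset.sum_congr rfl fun a' _ => ?_
  rw [← mul_one (Y a a'), ← smul_eq_mul (Y a a') 1, ← Matrix.smul_single, map_smul,
    ← mul_one ((Fintype.card A : ℂ)⁻¹), ← smul_eq_mul _ (1 : ℂ), ← Matrix.smul_single, map_smul]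
  simp only [Matrix.smul_apply, smul_eq_mul]
  field_simp

theorem choi_injective : Function.Injective (choi : Superop A B → _) :=
  Function.LeftInverse.injective ofChoi_choi

theorem choi_ofChoi (M : Matrix (A × B) (A × B) ℂ) : choi (ofChoi M) = M := by
  have hd : (Fintype.card A : ℂ) ≠ 0 := Nat.cast_ne_zero.mpr Fintype.card_ne_zero
  ext p q
  simp [choi_apply, ofChoi_apply, Matrix.single_apply, ite_and, hd]

variable [Fintype B]

theorem IsChannel.trace_choi {F : Superop A B} (hF : IsChannel F) : (choi F).trace = 1 := by
  have hd : (Fintype.card A : ℂ) ≠ 0 := Nat.cast_ne_zero.mpr Fintype.card_ne_zero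
  have : (choi F).trace = ∑ a, (F (Matrix.single a a ((Fintype.card A : ℂ)⁻¹))).trace := by
    simp [Matrix.trace, Fintype.sum_prod_type, choi_apply]
  rw [this]
  simp [hF.trace_map, hd]

/-- The Choi operators of channels form a compact set. -/
theorem isCompact_setOf_isChannel_ofChoi :
    IsCompact {M : Matrix (A × B) (A × B) ℂ | IsChannel (ofChoi M)} := by
  have hK : IsCompact (Set.univ.pi fun _ : A × B => Set.univ.pi fun _ : A × B =>
      Metric.closedBall (0 : ℂ) 1) :=
    isCompact_univ_pi fun _ => isCompact_univ_pi fun _ => isCompact_closedBall _ _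
  refine hK.of_isClosed_subset isClosed_setOf_isChannel_ofChoi fun (M : Matrix (A × B) (A × B) ℂ)
    hM p _ q _ => ?_
  have h1 := hM.cp.posSemidef_choi
  have h2 := hM.trace_choi
  rw [choi_ofChoi] at h1 h2
  simpa [h2] using norm_apply_le_trace h1 p q

end Choi

/-! ### Composition of allowed operations -/

section AllowedOperations

variable {A B K X Y : Type*} [Fintype A] [Fintype B] [Fintype K] [Fintype X] [Fintype Y]

theorem preAO_nonempty [Nonempty X] : (preAO A B K X).Nonempty := by
  classical
  obtain ⟨x⟩ := ‹Nonempty X›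
  exact ⟨_, LinearMap.id, fun _ => LinearMap.id, fun _ => Pi.single x 1, IsChannel.id,
    fun _ => IsChannel.id, fun _ => single_mem_stdSimplex ℝ x, fun _ _ => rfl⟩

theorem id_mem_preAO : (id : (X → Superop A B) → _) ∈ preAO A B X X := by
  classical
  refine ⟨LinearMap.id, fun _ => LinearMap.id, fun x => Pi.single x 1, IsChannel.id,
    fun _ => IsChannel.id, fun x => single_mem_stdSimplex ℝ x, fun E x => ?_⟩
  simp [Pi.single_apply]

/-- The second post-processing depends on the intermediate outcome `x`, which `k` determines only
randomly, so the composite is placed in the hull rather than in `preAO`. Writing `P₁` as a mixture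
of deterministic maps `f : K → X` makes each term a `preAO` transformation with channels `D₂ (f k) ∘
D₁ k`. -/
theorem comp_mem_AO_of_mem_preAO {Θ : (K → Superop A B) → X → Superop A B}
    {Ξ : (X → Superop A B) → Y → Superop A B} (hΘ : Θ ∈ preAO A B K X) (hΞ : Ξ ∈ preAO A B X Y) :
    Ξ ∘ Θ ∈ AO A B K Y := by
  classical
  obtain ⟨C₁, D₁, P₁, hC₁, hD₁, hP₁, hΘ⟩ := hΘ
  obtain ⟨C₂, D₂, P₂, hC₂, hD₂, hP₂, hΞ⟩ := hΞ
  -- The composite as a linear function of the first conditional distribution, so that convex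
  -- decompositions of `P₁` carry over.
  let Φ : (K → X → ℝ) →ₗ[ℝ] ((K → Superop A B) → Y → Superop A B) :=
    { toFun := fun P E y =>
        ∑ x, ∑ k, (P k x * P₂ x y) • ((D₂ x ∘ₗ D₁ k) ∘ₗ E k ∘ₗ (C₁ ∘ₗ C₂))
      map_add' := fun P P' => by
        ext E y : 2
        simp [add_mul, add_smul, Finset.sum_add_distrib]
      map_smul' := fun c P => by
        ext E y : 2
        simp [mul_assoc, mul_smul, Finset.smul_sum] }
  have hΦ : Ξ ∘ Θ = Φ P₁ := by
    ext E y : 2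
    simp only [Function.comp_apply, hΞ, hΘ, Φ, LinearMap.coe_mk, AddHom.coe_mk]
    refine Finset.sum_congr rfl fun x _ => ?_
    refine LinearMap.ext fun M => ?_
    simp only [LinearMap.smul_apply, LinearMap.comp_apply, LinearMap.sum_apply, map_sum,
      Finset.smul_sum]
    refine Finset.sum_congr rfl fun k _ => ?_
    rw [LinearMap.map_smul_of_tower, smul_smul, mul_comm]
  -- A product of simplices is the hull of the products of vertices, i.e. of the deterministic
  -- assignments.
  have hP : P₁ ∈ convexHull ℝ
      (Set.univ.pi fun _ : K => Set.range fun x : X => Pi.single x (1 : ℝ)) := by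
    rw [convexHull_pi]
    intro k _
    rw [convexHull_rangle_single_eq_stdSimplex]
    exact hP₁ k
  rw [hΦ]
  refine convexHull_min (t := Φ ⁻¹' AO A B K Y) ?_ ((convex_convexHull ℝ _).linear_preimage Φ) hP
  intro P hP
  choose f hf using fun k => hP k (Set.mem_univ k)
  refine subset_convexHull ℝ _ ⟨C₁ ∘ₗ C₂, fun k => D₂ (f k) ∘ₗ D₁ k, fun k => P₂ (f k),
    hC₁.comp hC₂, fun k => (hD₂ _).comp (hD₁ k), fun k => hP₂ _, fun E y => ?_⟩
  simp only [Φ, LinearMap.coe_mk, AddHom.coe_mk, ← hf]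
  rw [Finset.sum_comm]
  refine Finset.sum_congr rfl fun k _ => ?_
  rw [Finset.sum_eq_single (f k) (fun x _ hx => by simp [hx]) (by simp)]
  simp

/-- Transformations in `preAO` are real-linear. -/
theorem preAO_map_combo {Ξ : (X → Superop A B) → Y → Superop A B} (hΞ : Ξ ∈ preAO A B X Y)
    (a b : ℝ) (F G : X → Superop A B) : Ξ (a • F + b • G) = a • Ξ F + b • Ξ G := by
  obtain ⟨C, D, P, -, -, -, hΞ⟩ := hΞ
  ext y : 1
  simp only [Pi.add_apply, Pi.smul_apply, hΞ, Finset.smul_sum, ← Finset.sum_add_distrib]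
  refine Finset.sum_congr rfl fun x _ => LinearMap.ext fun M => ?_
  simp only [LinearMap.smul_apply, LinearMap.comp_apply, LinearMap.add_apply, map_add,
    LinearMap.map_smul_of_tower, smul_add]
  rw [smul_comm a, smul_comm b]

/-- Extend from `preAO` to the hull in each argument: composition is linear in the outer map by
definition, and convex combinations of inner maps are preserved because `preAO` maps are
real-linear. -/
theorem AO_comp {Θ : (K → Superop A B) → X → Superop A B}
    {Ξ : (X → Superop A B) → Y → Superop A B} (hΘ : Θ ∈ AO A B K X) (hΞ : Ξ ∈ AO A B X Y) :
    Ξ ∘ Θ ∈ AO A B K Y := by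
  refine convexHull_min (t := {Ξ | Ξ ∘ Θ ∈ AO A B K Y}) (fun Ξ hΞ => ?_) ?_ hΞ
  · refine convexHull_min (t := {Θ | Ξ ∘ Θ ∈ AO A B K Y})
      (fun Θ hΘ => comp_mem_AO_of_mem_preAO hΘ hΞ) ?_ hΘ
    intro Θ₁ h₁ Θ₂ h₂ a b ha hb hab
    have : Ξ ∘ (a • Θ₁ + b • Θ₂) = a • (Ξ ∘ Θ₁) + b • (Ξ ∘ Θ₂) :=
      funext fun E => preAO_map_combo hΞ a b _ _
    rw [Set.mem_ofPred_eq, this]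
    exact convex_convexHull ℝ (preAO A B K Y) h₁ h₂ ha hb hab
  · intro Ξ₁ h₁ Ξ₂ h₂ a b ha hb hab
    exact convex_convexHull ℝ (preAO A B K Y) h₁ h₂ ha hb hab

theorem IsInstrument.nonempty [Nonempty A] {E : K → Superop A B} (hE : IsInstrument E) :
    Nonempty K := by
  classical
  by_contra h
  rw [not_nonempty_iff] at h
  have := hE.channel.trace_map 1
  simp [eq_comm] at this

theorem IsInstrument.preAO_apply {E : K → Superop A B} (hE : IsInstrument E)
    {Θ : (K → Superop A B) → X → Superop A B} (hΘ : Θ ∈ preAO A B K X) : IsInstrument (Θ E) := by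
  obtain ⟨C, D, P, hC, hD, hP, hΘ⟩ := hΘ
  have hcp : ∀ x, IsCP (Θ E x) := fun x => by
    rw [hΘ]
    exact IsCP.sum_smul _ (fun k => (hP k).1 x) fun k => (hD k).cp.comp ((hE.cp k).comp hC.cp)
  refine ⟨hcp, ?_, fun M => ?_⟩
  · have := IsCP.sum_smul Finset.univ (p := fun _ : X => 1) (fun _ => zero_le_one) hcp
    simpa using this
  · simp only [LinearMap.sum_apply, hΘ, Matrix.trace_sum, LinearMap.smul_apply,
      Matrix.trace_smul, LinearMap.comp_apply, (hD _).trace_map]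
    rw [Finset.sum_comm]
    simp only [← Finset.sum_smul, (hP _).2, one_smul]
    rw [← hC.trace_map M, ← hE.channel.trace_map (C M), LinearMap.sum_apply, Matrix.trace_sum]

end AllowedOperations

/-! ### The compact convex set of reachable Choi families -/

section Reachability

variable {A B K X : Type*} [Fintype A] [DecidableEq A] [Fintype B] [Fintype K] [Fintype X]

theorem pSucc_eq [DecidableEq B] (F : X → Superop A B) (Q : POVM (Option X) (A × B)) :
    pSucc F Q = ∑ x, ((Q.effect (some x) * choi (F x)).trace).re := rfl

/-- Applying a transformation to `E` and taking Choi operators, as a linear map. -/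
noncomputable def choiEval (E : K → Superop A B) :
    ((K → Superop A B) → X → Superop A B) →ₗ[ℝ] (X → Matrix (A × B) (A × B) ℂ) where
  toFun Θ x := choi (Θ E x)
  map_add' _ _ := funext fun _ => map_add choi _ _
  map_smul' _ _ := funext fun _ => map_smul choi _ _

/-- The Choi families that can be reached from `E` by allowed operations. -/
def reachableChoi (X : Type*) [Fintype X] (E : K → Superop A B) :
    Set (X → Matrix (A × B) (A × B) ℂ) :=
  choiEval E '' AO A B K X

theorem convex_reachableChoi (E : K → Superop A B) : Convex ℝ (reachableChoi X E) :=
  (convex_convexHull ℝ _).linear_image _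

theorem reachable_eq_image [DecidableEq B] (E : K → Superop A B)
    (Q : POVM (Option X) (A × B)) :
    reachable E Q = (fun M : X → Matrix (A × B) (A × B) ℂ =>
      ∑ x, ((Q.effect (some x) * M x).trace).re) '' reachableChoi X E := by
  ext p
  simp only [reachable, reachableChoi, Set.image_image, Set.mem_image, Set.mem_ofPred_eq]
  exact ⟨fun ⟨Θ, h, e⟩ => ⟨Θ, h, e.symm⟩, fun ⟨Θ, h, e⟩ => ⟨Θ, h, e.symm⟩⟩

theorem isCompact_reachableChoi [DecidableEq B] [Nonempty A] [Nonempty B] (E : K → Superop A B) :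
    IsCompact (reachableChoi X E) := by
  have himg : reachableChoi X E = convexHull ℝ (choiEval E '' preAO A B K X) :=
    (choiEval E).image_convexHull _
  rw [himg]
  refine isCompact_convexHull_of_finiteDimensional (V := X → A × B → A × B → ℂ) ?_
  -- Parametrization by the Choi operators of the channels and the conditional distributions, which
  -- range over a compact set.
  let Ψ : Matrix (A × A) (A × A) ℂ × (K → Matrix (B × B) (B × B) ℂ) × (K → X → ℝ) →
      X → Matrix (A × B) (A × B) ℂ :=
    fun t x => choi (∑ k, t.2.2 k x • (ofChoi (t.2.1 k) ∘ₗ E k ∘ₗ ofChoi t.1))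
  have hΨ : Continuous Ψ := by
    refine continuous_pi fun x => continuous_matrix fun p q => ?_
    simp only [Ψ, choi_apply, LinearMap.sum_apply, LinearMap.smul_apply, LinearMap.comp_apply,
      Matrix.sum_apply, Matrix.smul_apply]
    refine continuous_finsetSum _ fun k _ => ?_
    have hw : Continuous fun t : Matrix (A × A) (A × A) ℂ × (K → Matrix (B × B) (B × B) ℂ) ×
        (K → X → ℝ) => t.2.2 k x := by fun_prop
    refine hw.smul ?_
    refine Continuous.matrix_elem ?_ p.2 q.2
    refine continuous_ofChoi_apply (by fun_prop) ?_
    exact (LinearMap.continuous_of_finiteDimensional (E k)).comp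
      (continuous_ofChoi_apply continuous_fst continuous_const)
  have hS : choiEval E '' preAO A B K X = Ψ '' ({M | IsChannel (ofChoi M)} ×ˢ
      (Set.univ.pi fun _ => {M | IsChannel (ofChoi M)}) ×ˢ
      (Set.univ.pi fun _ => stdSimplex ℝ X)) := by
    apply Set.Subset.antisymm
    · rintro _ ⟨Θ, ⟨C, D, P, hC, hD, hP, hΘ⟩, rfl⟩
      refine ⟨⟨choi C, fun k => choi (D k), P⟩, ⟨?_, fun k _ => ?_, fun k _ => hP k⟩, ?_⟩
      · simpa only [Set.mem_ofPred_eq, ofChoi_choi] using hC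
      · simpa only [Set.mem_ofPred_eq, ofChoi_choi] using hD k
      · ext x : 1
        simp only [Ψ, ofChoi_choi]
        exact congrArg choi (hΘ E x).symm
    · rintro _ ⟨⟨c, d, P⟩, ⟨hc, hd, hP⟩, rfl⟩
      exact ⟨fun E x => ∑ k, P k x • (ofChoi (d k) ∘ₗ E k ∘ₗ ofChoi c), ⟨ofChoi c,
        fun k => ofChoi (d k), P, hc, fun k => hd k (Set.mem_univ k),
        fun k => hP k (Set.mem_univ k), fun _ _ => rfl⟩, rfl⟩
  rw [hS]
  exact (isCompact_setOf_isChannel_ofChoi.prod ((isCompact_univ_pi fun _ =>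
    isCompact_setOf_isChannel_ofChoi).prod (isCompact_univ_pi fun _ =>
      isCompact_stdSimplex ℝ X))).image hΨ

theorem isGreatest_pMax [DecidableEq B] [Nonempty A] [Nonempty B] [Nonempty X]
    (E : K → Superop A B) (Q : POVM (Option X) (A × B)) : IsGreatest (reachable E Q) (pMax E Q) := by
  have hc : IsCompact (reachable E Q) := by
    rw [reachable_eq_image]
    refine (isCompact_reachableChoi E).image (continuous_finsetSum _ fun x _ => ?_)
    exact Complex.continuous_re.comp (by fun_prop)
  obtain ⟨Θ, hΘ⟩ := preAO_nonempty (A := A) (B := B) (K := K) (X := X)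
  exact hc.isGreatest_sSup ⟨_, Θ, subset_convexHull ℝ _ hΘ, rfl⟩

theorem IsInstrument.choi_isHermitian_and_sum_trace [Nonempty A] {F : X → Superop A B}
    (hF : IsInstrument F) :
    (∀ x, (choi (F x)).IsHermitian) ∧ ∑ x, (choi (F x)).trace.re = 1 := by
  refine ⟨fun x => (hF.cp x).posSemidef_choi.isHermitian, ?_⟩
  rw [← Complex.re_sum, ← Matrix.trace_sum, ← map_sum, hF.channel.trace_choi, Complex.one_re]

/-- Reachable Choi families consist of Hermitian operators with total trace one. -/
theorem reachableChoi_subset [Nonempty A] {E : K → Superop A B} (hE : IsInstrument E) :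
    reachableChoi X E ⊆ {M | (∀ x, (M x).IsHermitian) ∧ ∑ x, (M x).trace.re = 1} := by
  have himg : reachableChoi X E = convexHull ℝ (choiEval E '' preAO A B K X) :=
    (choiEval E).image_convexHull _
  rw [himg]
  refine convexHull_min ?_ ?_
  · rintro _ ⟨Θ, hΘ, rfl⟩
    exact (hE.preAO_apply hΘ).choi_isHermitian_and_sum_trace
  · rintro M ⟨hM, hM1⟩ M' ⟨hM', hM1'⟩ a b - - hab
    refine ⟨fun x => ?_, ?_⟩
    · have h1 := hM x
      have h2 := hM' x
      rw [Matrix.IsHermitian] at h1 h2 ⊢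
      simp [Matrix.conjTranspose_add, Matrix.conjTranspose_smul, h1, h2]
    · simp [Finset.sum_add_distrib, ← Finset.mul_sum, hM1, hM1', hab]

end Reachability

/-! ### From separating functionals to POVMs -/

section Discrimination

variable {A B K X : Type*} [Fintype A] [DecidableEq A] [Fintype B] [DecidableEq B] [Fintype K]
  [Fintype X]

theorem re_trace_conjTranspose_mul {n : Type*} [Fintype n] (H : Matrix n n ℂ) {M : Matrix n n ℂ}
    (hM : M.IsHermitian) : ((H.conjTranspose * M).trace).re = ((H * M).trace).re := by
  have : (H.conjTranspose * M).trace = star ((H * M).trace) := by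
    rw [← Matrix.trace_conjTranspose, Matrix.conjTranspose_mul, hM.eq, Matrix.trace_mul_comm]
  rw [this]
  simp

/-- Up to a positive affine rescaling, every family of matrices pairs with the Hermitian families of
total trace one like a POVM with an additional outcome. -/
theorem exists_povm_affine {n : Type*} [Fintype n] [DecidableEq n] (H : X → Matrix n n ℂ) :
    ∃ (Q : POVM (Option X) n) (ε l : ℝ), 0 < ε ∧ ∀ M : X → Matrix n n ℂ,
      (∀ x, (M x).IsHermitian) → ∑ x, (M x).trace.re = 1 →
      ∑ x, ((Q.effect (some x) * M x).trace).re = ε * (∑ x, ((H x * M x).trace).re + l) := by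
  -- Hermitization merely doubles the real pairing with Hermitian `M x`; this is the 2 in `ε = 2 *
  -- m⁻¹`.
  let G : X → Matrix n n ℂ := fun x => H x + (H x).conjTranspose
  have hG : ∀ x, (G x).IsHermitian := fun x => Matrix.isHermitian_add_transpose_self (H x)
  choose c hc using fun x => exists_posSemidef_add_smul_one (hG x)
  let l : ℝ := ∑ x, |c x|
  have hl : ∀ x, c x ≤ l := fun x => (le_abs_self _).trans
    (Finset.single_le_sum (f := fun x => |c x|) (fun _ _ => abs_nonneg _) (Finset.mem_univ x))
  let R : X → Matrix n n ℂ := fun x => G x + (l : ℂ) • (1 : Matrix n n ℂ)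
  have hR : ∀ x, (R x).PosSemidef := fun x => hc x l (hl x)
  obtain ⟨d, hd⟩ := exists_posSemidef_add_smul_one
    (Matrix.posSemidef_sum Finset.univ fun x _ => hR x).isHermitian.neg
  -- The maximum with 1 keeps `m` positive; `m ≥ d` makes the inconclusive effect positive
  -- semidefinite.
  let m : ℝ := max d 1
  have hm : 0 < m := lt_of_lt_of_le one_pos (le_max_right _ _)
  refine ⟨⟨fun o => o.elim (m⁻¹ • (-∑ x, R x + (m : ℂ) • (1 : Matrix n n ℂ))) fun x => m⁻¹ • R x,
    ?_, ?_⟩, 2 * m⁻¹, l / 2, by positivity, fun M hM hM1 => ?_⟩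
  · rintro (_ | x)
    · exact (hd m (le_max_left _ _)).real_smul (inv_nonneg.mpr hm.le)
    · exact (hR x).real_smul (inv_nonneg.mpr hm.le)
  · rw [Fintype.sum_option]
    simp only [Option.elim, ← Finset.smul_sum, ← smul_add]
    rw [neg_add_eq_sub, sub_add_cancel, Complex.coe_smul, smul_smul, inv_mul_cancel₀ hm.ne',
      one_smul]
  · have hx : ∀ x, (((m⁻¹ • R x) * M x).trace).re =
        m⁻¹ * (2 * ((H x * M x).trace).re + l * (M x).trace.re) := fun x => by
      rw [Matrix.smul_mul, Matrix.trace_smul, Complex.smul_re, Matrix.add_mul, Matrix.add_mul,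
        Matrix.trace_add, Matrix.trace_add, Complex.add_re, Complex.add_re,
        re_trace_conjTranspose_mul _ (hM x), Complex.coe_smul, Matrix.smul_mul, Matrix.one_mul,
        Matrix.trace_smul, Complex.smul_re, smul_eq_mul, smul_eq_mul, two_mul]
    simp only [Option.elim, hx]
    rw [← Finset.mul_sum, Finset.sum_add_distrib, ← Finset.mul_sum, ← Finset.mul_sum, hM1]
    ring

/-- An instrument that is not reachable is better for some POVM than everything reachable. -/
theorem exists_povm_pMax_lt [Nonempty A] [Nonempty B] [Nonempty X] {E : K → Superop A B}
    (hE : IsInstrument E) {N : X → Superop A B} (hN : IsInstrument N)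
    (hEN : ¬ ∃ Θ ∈ AO A B K X, Θ E = N) :
    ∃ Q : POVM (Option X) (A × B), pMax E Q < pSucc N Q := by
  have hmem : (fun x => choi (N x)) ∉ reachableChoi X E := by
    rintro ⟨Θ, hΘ, h⟩
    exact hEN ⟨Θ, hΘ, funext fun x => choi_injective (congrFun h x)⟩
  obtain ⟨H, u, h1, h2⟩ := exists_trace_separation (convex_reachableChoi E)
    (isCompact_reachableChoi E).isClosed hmem
  obtain ⟨Q, ε, l, hε, hQ⟩ := exists_povm_affine H
  refine ⟨Q, ?_⟩
  have hp := (isGreatest_pMax E Q).1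
  rw [reachable_eq_image] at hp
  obtain ⟨M, hM, hMp⟩ := hp
  have hM' := reachableChoi_subset hE hM
  have hN' := hN.choi_isHermitian_and_sum_trace
  rw [← hMp, pSucc_eq]
  dsimp only
  rw [hQ M hM'.1 hM'.2, hQ (fun x => choi (N x)) hN'.1 hN'.2]
  exact mul_lt_mul_of_pos_left (by linarith [h1 M hM]) hε

theorem reachable_subset_of_mem_AO {L : Type*} [Fintype L] {E : L → Superop A B}
    {Θ : (L → Superop A B) → K → Superop A B} (hΘ : Θ ∈ AO A B L K)
    (Q : POVM (Option X) (A × B)) : reachable (Θ E) Q ⊆ reachable E Q := by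
  rintro _ ⟨Ξ, hΞ, rfl⟩
  exact ⟨Ξ ∘ Θ, AO_comp hΘ hΞ, rfl⟩

theorem pSucc_le_pMax [Nonempty A] [Nonempty B] [Nonempty X] (N : X → Superop A B)
    (Q : POVM (Option X) (A × B)) : pSucc N Q ≤ pMax N Q :=
  (isGreatest_pMax N Q).2 ⟨id, subset_convexHull ℝ _ id_mem_preAO, rfl⟩

end Discrimination

end InteractiveInstruments

theorem mainTheorem1 {A B K X : Type*}
    [Fintype A] [DecidableEq A] [Nonempty A] [Fintype B] [DecidableEq B] [Nonempty B]
    [Fintype K] [Fintype X]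
    (E : K → InteractiveInstruments.Superop A B) (hE : InteractiveInstruments.IsInstrument E)
    (N : X → InteractiveInstruments.Superop A B) (hN : InteractiveInstruments.IsInstrument N) :
    (∀ Q : InteractiveInstruments.POVM (Option X) (A × B),
      IsGreatest (InteractiveInstruments.reachable E Q) (InteractiveInstruments.pMax E Q) ∧
      IsGreatest (InteractiveInstruments.reachable N Q) (InteractiveInstruments.pMax N Q)) ∧
    ((∃ Θ ∈ InteractiveInstruments.AO A B K X, Θ E = N) ↔
      ∀ Q : InteractiveInstruments.POVM (Option X) (A × B),
        InteractiveInstruments.pMax E Q ≥ InteractiveInstruments.pMax N Q) := by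
  have : Nonempty X := hN.nonempty
  refine ⟨fun Q => ⟨InteractiveInstruments.isGreatest_pMax E Q,
    InteractiveInstruments.isGreatest_pMax N Q⟩, ?_, fun h => ?_⟩
  · rintro ⟨Θ, hΘ, rfl⟩ Q
    exact (InteractiveInstruments.isGreatest_pMax E Q).2
      (InteractiveInstruments.reachable_subset_of_mem_AO hΘ Q
        (InteractiveInstruments.isGreatest_pMax (Θ E) Q).1)
  · by_contra hEN
    obtain ⟨Q, hQ⟩ := InteractiveInstruments.exists_povm_pMax_lt hE hN hEN
    exact absurd (hQ.trans_le (InteractiveInstruments.pSucc_le_pMax N Q)) (not_lt.mpr (h Q))
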